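/- Let $n,q\ge 2$ be integers, let $H\in(\tfrac12,1)$ and put $H_0=1-\frac{1-H}{q}$. Let $A_{n,q}$ be the set of multi-indices $\alpha=(\alpha_{ij})_{1\le i<j\le n}$ of non-negative integers such that, for each $k=1,\dots,n$, $\sum_{1\le i<j\le n}\alpha_{ij}\mathbf 1_{k\in\{i,j\}}\le q$. Let $\alpha\in A_{n,q}$ and let $x:\mathbb R\to\mathbb R$ belong to $L^1(\mathbb R)\cap L^{1/H}(\mathbb R)$. Then $$\int_{\mathbb R^n}\prod_{k=1}^n|x(\eta_k)|\prod_{1\le i<j\le n}|\eta_i-\eta_j|^{(2H_0-2)\alpha_{ij}}\,d\eta_1\cdots d\eta_n<\infty.$$ -/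

import Mathlib

open MeasureTheory
open scoped ENNReal

/-- The index set of pairs `(i, j)` with `i < j`, for indices in `Fin n`. -/
abbrev IncPair (n : ℕ) : Type := {p : Fin n × Fin n // p.1 < p.2}

/-- The set `A_{n,q}` of multi-indices `α = (α_{ij})_{i < j}` with natural number entries such that,
for each `k`, the sum of the `α_{ij}` over the pairs `i < j` with `k ∈ {i, j}` is at most `q`. -/
def multiIndexSet (n q : ℕ) : Set (IncPair n → ℕ) :=
  {α | ∀ k : Fin n, (∑ p : IncPair n, if k = p.1.1 ∨ k = p.1.2 then α p else 0) ≤ q}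

/-- The parameter `H₀ = 1 - (1 - H) / q`. -/
noncomputable def selfSimH0 (H : ℝ) (q : ℕ) : ℝ := 1 - (1 - H) / (q : ℝ)

/-! Since `2 * H₀ - 2 = -2 * (1 - H) / q`, each pair factor is the kernel `|a - b| ^ (-2(1 - H))`
raised to the weight `α p / q`, and membership in `A_{n,q}` says that the weights meeting any vertex
sum to at most 1. Giving the deficit at each vertex to a singleton factor makes them sum to exactly
1, so Finner's generalised Hölder inequality (`lmarginal_prod_rpow_le`) bounds the integral by
powers of `∫ |x|` and of `∬ |x(a)| |x(b)| |a - b| ^ (-2(1 - H))`. The latter is finite by the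
Hardy–Littlewood–Sobolev inequality with exponent `1 / H`
(`lintegral_lintegral_mul_enorm_sub_rpow_lt_top`). -/

/-! ### Finner's inequality. -/

theorem lmarginal_prod_rpow_le {δ ι : Type*} [DecidableEq δ] [Fintype ι] {X : δ → Type*}
    [∀ k, MeasurableSpace (X k)] {μ : ∀ k, Measure (X k)} [∀ k, SigmaFinite (μ k)]
    (S : ι → Finset δ) {w : ι → ℝ} (hw : ∀ i, 0 ≤ w i) {g : ι → (∀ k, X k) → ℝ≥0∞}
    (hg : ∀ i, Measurable (g i)) (hdep : ∀ i, DependsOn (g i) (S i : Set δ)) (s : Finset δ)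
    (hs : ∀ k ∈ s, ∑ i with k ∈ S i, w i = 1) (x : ∀ k, X k) :
    lmarginal μ s (fun y ↦ ∏ i, g i y ^ w i) x ≤
      ∏ i, lmarginal μ (s ∩ S i) (g i) x ^ w i := by
  induction s using Finset.induction_on generalizing x with
  | empty => simp
  | insert k s hk ih =>
    have hmeas : Measurable fun y ↦ ∏ i, g i y ^ w i :=
      Finset.measurable_fun_prod _ fun i _ ↦ (hg i).pow_const _
    rw [lmarginal_insert _ hmeas hk]
    have hind : ∀ i, k ∉ S i → ∀ y : X k,
        lmarginal μ (s ∩ S i) (g i) (Function.update x k y) = lmarginal μ (s ∩ S i) (g i) x := by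
      intro i hi y
      rw [lmarginal_update_of_notMem (hg i) (by simp [hk])]
      congr 1
      ext z
      refine hdep i fun j hj ↦ Function.update_of_ne ?_ _ _
      rintro rfl
      exact hi hj
    calc
      _ ≤ ∫⁻ y, ∏ i, lmarginal μ (s ∩ S i) (g i) (Function.update x k y) ^ w i ∂μ k :=
        lintegral_mono fun y ↦ ih (fun j hj ↦ hs j (Finset.mem_insert_of_mem hj)) _
      _ = ∫⁻ y, (∏ i with k ∈ S i, lmarginal μ (s ∩ S i) (g i) (Function.update x k y) ^ w i) *
            ∏ i with k ∉ S i, lmarginal μ (s ∩ S i) (g i) x ^ w i ∂μ k := by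
        refine lintegral_congr fun y ↦ ?_
        rw [← Finset.prod_filter_mul_prod_filter_not Finset.univ (fun i ↦ k ∈ S i)]
        congr 1
        refine Finset.prod_congr rfl fun i hi ↦ ?_
        rw [hind i (Finset.mem_filter.1 hi).2]
      _ = (∫⁻ y, ∏ i with k ∈ S i,
              lmarginal μ (s ∩ S i) (g i) (Function.update x k y) ^ w i ∂μ k) *
            ∏ i with k ∉ S i, lmarginal μ (s ∩ S i) (g i) x ^ w i := by
        refine lintegral_mul_const _ ?_
        exact Finset.measurable_fun_prod _ fun i _ ↦
          (((hg i).lmarginal μ).comp (measurable_update x)).pow_const _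
      -- Hölder in the single variable `k`: only the factors depending on it remain, and their
      -- weights sum to 1.
      _ ≤ (∏ i with k ∈ S i,
              (∫⁻ y, lmarginal μ (s ∩ S i) (g i) (Function.update x k y) ∂μ k) ^ w i) *
            ∏ i with k ∉ S i, lmarginal μ (s ∩ S i) (g i) x ^ w i := by
        gcongr
        exact ENNReal.lintegral_prod_norm_pow_le _
          (fun i _ ↦ (((hg i).lmarginal μ).comp (measurable_update x)).aemeasurable)
          (hs k (Finset.mem_insert_self _ _)) fun i _ ↦ hw i
      _ = _ := by
        rw [← Finset.prod_filter_mul_prod_filter_not Finset.univ (fun i ↦ k ∈ S i)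
          (fun i ↦ lmarginal μ (insert k s ∩ S i) (g i) x ^ w i)]
        congr 1
        · refine Finset.prod_congr rfl fun i hi ↦ ?_
          rw [Finset.insert_inter_of_mem (Finset.mem_filter.1 hi).2,
            lmarginal_insert _ (hg i) (by simp [hk])]
        · refine Finset.prod_congr rfl fun i hi ↦ ?_
          rw [Finset.insert_inter_of_notMem (Finset.mem_filter.1 hi).2]

/-! ### A Hardy–Littlewood–Sobolev estimate on the line. -/

theorem lintegral_comp_enorm_eq_two_mul_setLIntegral_Ioi (g : ℝ≥0∞ → ℝ≥0∞) :
    ∫⁻ t : ℝ, g ‖t‖ₑ = 2 * ∫⁻ t in Set.Ioi (0 : ℝ), g (ENNReal.ofReal t) := by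
  have hpos : ∫⁻ t in Set.Ioi (0 : ℝ), g ‖t‖ₑ = ∫⁻ t in Set.Ioi (0 : ℝ), g (ENNReal.ofReal t) :=
    setLIntegral_congr_fun measurableSet_Ioi fun t (ht : 0 < t) ↦ by
      simp only [Real.enorm_eq_ofReal ht.le]
  have hneg : ∫⁻ t in Set.Iio (0 : ℝ), g ‖t‖ₑ = ∫⁻ t in Set.Ioi (0 : ℝ), g ‖t‖ₑ := by
    have := (Measure.measurePreserving_neg (volume : Measure ℝ)).setLIntegral_comp_preimage_emb
      (MeasurableEquiv.neg ℝ).measurableEmbedding (fun t ↦ g ‖t‖ₑ) (Set.Ioi 0)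
    simpa using this
  rw [← lintegral_add_compl _ (measurableSet_Ioi (a := (0 : ℝ))), Set.compl_Ioi,
    setLIntegral_congr Iio_ae_eq_Iic.symm, hneg, hpos, two_mul]

theorem lintegral_enorm_rpow_near_zero {a : ℝ} (ha : a < 1) {R : ℝ≥0∞} (hR : R ≠ ∞) :
    ∫⁻ t : ℝ, (if ‖t‖ₑ < R then ‖t‖ₑ ^ (-a) else 0) =
      2 * ENNReal.ofReal (1 / (1 - a)) * R ^ (1 - a) := by
  lift R to NNReal using hR
  rw [lintegral_comp_enorm_eq_two_mul_setLIntegral_Ioi (fun u ↦ if u < R then u ^ (-a) else 0),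
    mul_assoc]
  congr 1
  have h1 : ∫⁻ t in Set.Ioi (0 : ℝ),
      (if ENNReal.ofReal t < R then ENNReal.ofReal t ^ (-a) else 0) =
      ∫⁻ t in Set.Ioo (0 : ℝ) R, ENNReal.ofReal (t ^ (-a)) := by
    rw [← lintegral_indicator measurableSet_Ioi, ← lintegral_indicator measurableSet_Ioo]
    refine lintegral_congr fun t ↦ ?_
    by_cases ht : 0 < t
    · have : ENNReal.ofReal t < R ↔ t < R := by
        rw [← ENNReal.ofReal_coe_nnreal, ENNReal.ofReal_lt_ofReal_iff_of_nonneg ht.le]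
      by_cases h : t < R <;>
        simp [Set.indicator, ht, this, h, ENNReal.ofReal_rpow_of_pos ht]
    · simp [Set.indicator, ht]
  have hint : IntervalIntegrable (fun t : ℝ ↦ t ^ (-a)) volume 0 R :=
    intervalIntegral.intervalIntegrable_rpow' (by linarith)
  rw [h1, setLIntegral_congr Ioo_ae_eq_Ioc, ← ofReal_integral_eq_lintegral_ofReal
      ((intervalIntegrable_iff_integrableOn_Ioc_of_le R.coe_nonneg).1 hint)
      ((ae_restrict_iff' measurableSet_Ioc).2 (.of_forall fun t ht ↦ Real.rpow_nonneg ht.1.le _)),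
    ← intervalIntegral.integral_of_le R.coe_nonneg, integral_rpow (Or.inl (by linarith)),
    Real.zero_rpow (by linarith), ← ENNReal.ofReal_coe_nnreal,
    ENNReal.ofReal_rpow_of_nonneg R.coe_nonneg (by linarith), ← ENNReal.ofReal_mul (by
      have : 0 < 1 - a := by linarith
      positivity)]
  congr 1
  rw [neg_add_eq_sub]
  ring

theorem lintegral_enorm_rpow_far {R : ℝ≥0∞} (hR0 : R ≠ 0) (hR : R ≠ ∞) :
    ∫⁻ t : ℝ, (if ‖t‖ₑ < R then 0 else ‖t‖ₑ ^ (-2 : ℝ)) = 2 * R⁻¹ := by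
  lift R to NNReal using hR
  have hR1 : (0 : ℝ) < R := by simpa [pos_iff_ne_zero] using hR0
  rw [lintegral_comp_enorm_eq_two_mul_setLIntegral_Ioi
    (fun u ↦ if u < R then 0 else u ^ (-2 : ℝ))]
  congr 1
  have h1 : ∫⁻ t in Set.Ioi (0 : ℝ),
      (if ENNReal.ofReal t < R then 0 else ENNReal.ofReal t ^ (-2 : ℝ)) =
      ∫⁻ t in Set.Ici (R : ℝ), ENNReal.ofReal (t ^ (-2 : ℝ)) := by
    rw [← lintegral_indicator measurableSet_Ioi, ← lintegral_indicator measurableSet_Ici]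
    refine lintegral_congr fun t ↦ ?_
    by_cases ht : 0 < t
    · have : ENNReal.ofReal t < R ↔ t < R := by
        rw [← ENNReal.ofReal_coe_nnreal, ENNReal.ofReal_lt_ofReal_iff_of_nonneg ht.le]
      rw [Set.indicator_of_mem (show t ∈ Set.Ioi 0 from ht)]
      by_cases h : t < R
      · simp [this, h]
      · rw [Set.indicator_of_mem (show t ∈ Set.Ici (R : ℝ) from not_lt.1 h),
          if_neg (by rwa [this]), ENNReal.ofReal_rpow_of_pos ht]
    · rw [Set.indicator_of_notMem (by simpa using ht), Set.indicator_of_notMem]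
      simp only [Set.mem_Ici, not_le]
      linarith
  rw [h1, setLIntegral_congr Ioi_ae_eq_Ici.symm, ← ofReal_integral_eq_lintegral_ofReal
      (integrableOn_Ioi_rpow_of_lt (by norm_num) hR1)
      ((ae_restrict_iff' measurableSet_Ioi).2
        (.of_forall fun t ht ↦ Real.rpow_nonneg (hR1.trans ht).le _)),
    integral_Ioi_rpow_of_lt (by norm_num) hR1, ← ENNReal.ofReal_coe_nnreal,
    ← ENNReal.ofReal_inv_of_pos hR1]
  congr 1
  rw [← Real.rpow_neg_one]
  norm_num

/-- Near `y`, `f` is replaced by its bound `b` and the kernel is integrable; far from `y`, Hölder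
applies. -/
theorem lintegral_mul_enorm_rpow_le_of_le {θ : ℝ} (hθ0 : 0 < θ) (hθ : θ < 1 / 2) {f : ℝ → ℝ≥0∞}
    (hf : Measurable f) {b : ℝ≥0∞} (hb0 : b ≠ 0) (hb : b ≠ ∞) (y : ℝ) :
    ∫⁻ x, (if f x ≤ b then f x * ‖x - y‖ₑ ^ (-(2 * θ)) else 0) ≤
      (2 * ENNReal.ofReal (1 / (1 - 2 * θ)) +
        (∫⁻ x, f x ^ (1 / (1 - θ))) ^ (1 - θ) * 2 ^ θ) * b ^ (θ / (1 - θ)) := by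
  have h1θ : 0 < 1 - θ := by linarith
  -- This radius balances the near part `b * R ^ (1 - 2θ)` against the far part `R ^ (-θ)`: both
  -- equal `b ^ (θ / (1 - θ))`.
  set R : ℝ≥0∞ := b ^ (-(1 / (1 - θ))) with hRdef
  have hR0 : R ≠ 0 := by simp [hRdef, ENNReal.rpow_eq_zero_iff, hb0, hb]
  have hR : R ≠ ∞ := by simp [hRdef, ENNReal.rpow_eq_top_iff, hb0, hb]
  set near : ℝ → ℝ≥0∞ := fun t ↦ if ‖t‖ₑ < R then ‖t‖ₑ ^ (-(2 * θ)) else 0 with hnear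
  set far : ℝ → ℝ≥0∞ := fun t ↦ if ‖t‖ₑ < R then 0 else ‖t‖ₑ ^ (-(2 * θ)) with hfar
  have hset : MeasurableSet {t : ℝ | ‖t‖ₑ < R} := measurableSet_lt measurable_enorm measurable_const
  have hnm : Measurable near :=
    Measurable.ite hset (measurable_enorm.pow_const _) measurable_const
  have hfm : Measurable far :=
    Measurable.ite hset measurable_const (measurable_enorm.pow_const _)
  have hnear_le : ∫⁻ x, b * near (x - y) =
      2 * ENNReal.ofReal (1 / (1 - 2 * θ)) * b ^ (θ / (1 - θ)) := by
    rw [lintegral_const_mul' _ _ hb, lintegral_sub_right_eq_self near y, hnear,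
      lintegral_enorm_rpow_near_zero (by linarith) hR, mul_left_comm, hRdef, ← ENNReal.rpow_mul]
    congr 1
    conv_lhs => enter [1]; rw [← ENNReal.rpow_one b]
    rw [← ENNReal.rpow_add _ _ hb0 hb]
    congr 1
    field_simp
    ring
  have hfar_le : ∫⁻ x, f x * far (x - y) ≤
      (∫⁻ x, f x ^ (1 / (1 - θ))) ^ (1 - θ) * 2 ^ θ * b ^ (θ / (1 - θ)) := by
    -- The conjugate exponent `1 / θ` turns the kernel into `|t| ^ (-2)`, integrable at infinity.
    have hconj : (1 / (1 - θ)).HolderConjugate (1 / θ) := by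
      rw [Real.holderConjugate_iff]
      refine ⟨by rw [lt_div_iff₀ h1θ]; linarith, by simp⟩
    refine (ENNReal.lintegral_mul_le_Lp_mul_Lq volume hconj hf.aemeasurable
      (hfm.comp (measurable_id.sub_const y)).aemeasurable).trans_eq ?_
    have h2 : ∫⁻ x, far (x - y) ^ (1 / θ) = 2 * R⁻¹ := by
      rw [lintegral_sub_right_eq_self (fun x ↦ far x ^ (1 / θ)) y,
        ← lintegral_enorm_rpow_far hR0 hR]
      refine lintegral_congr fun t ↦ ?_
      simp only [hfar]
      split_ifs
      · rw [ENNReal.zero_rpow_of_pos (by positivity)]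
      · rw [← ENNReal.rpow_mul]
        congr 1
        field_simp
    simp only [Function.comp_apply, id, one_div_one_div] at h2 ⊢
    rw [one_div] at h2
    simp only [one_div] at h2 ⊢
    rw [h2, mul_assoc, ENNReal.mul_rpow_of_nonneg _ _ hθ0.le, hRdef, ← ENNReal.rpow_neg,
      ← ENNReal.rpow_mul]
    congr 3
    field_simp
  calc
    _ ≤ ∫⁻ x, (b * near (x - y) + f x * far (x - y)) := by
      refine lintegral_mono fun x ↦ ?_
      simp only [hnear, hfar]
      split_ifs with h1 h2
      · simp only [mul_zero, add_zero]; gcongr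
      · simp
      · simp
      · simp
    _ = (∫⁻ x, b * near (x - y)) + ∫⁻ x, f x * far (x - y) :=
      lintegral_add_left ((hnm.comp (measurable_id.sub_const y)).const_mul b) _
    _ ≤ _ := by
      rw [hnear_le, add_mul]
      gcongr

/-- By symmetry it suffices to treat `f x ≤ f y`. The previous bound with `b = f y` then leaves `f y
* f y ^ (θ / (1 - θ)) = f y ^ (1 / (1 - θ))`. -/
theorem lintegral_lintegral_mul_enorm_sub_rpow_lt_top {θ : ℝ} (hθ0 : 0 < θ) (hθ : θ < 1 / 2)
    {f : ℝ → ℝ≥0∞} (hf : Measurable f) (hft : ∀ x, f x ≠ ∞)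
    (hfp : ∫⁻ x, f x ^ (1 / (1 - θ)) < ∞) :
    ∫⁻ x, ∫⁻ y, f x * f y * ‖x - y‖ₑ ^ (-(2 * θ)) < ∞ := by
  have h1θ : 0 < 1 - θ := by linarith
  set G : ℝ → ℝ → ℝ≥0∞ := fun x y ↦
    f y * (if f x ≤ f y then f x * ‖x - y‖ₑ ^ (-(2 * θ)) else 0) with hG
  have hGm : Measurable (Function.uncurry G) := by
    refine (hf.comp measurable_snd).mul (Measurable.ite ?_ ?_ measurable_const)
    · exact measurableSet_le (hf.comp measurable_fst) (hf.comp measurable_snd)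
    · exact (hf.comp measurable_fst).mul
        ((measurable_fst.sub measurable_snd).enorm.pow_const _)
  set C : ℝ≥0∞ := 2 * ENNReal.ofReal (1 / (1 - 2 * θ)) +
    (∫⁻ x, f x ^ (1 / (1 - θ))) ^ (1 - θ) * 2 ^ θ with hC
  have hCt : C ≠ ∞ := by
    refine ENNReal.add_ne_top.2 ⟨ENNReal.mul_ne_top (by simp) ENNReal.ofReal_ne_top,
      ENNReal.mul_ne_top (ENNReal.rpow_ne_top_of_nonneg h1θ.le hfp.ne)
        (ENNReal.rpow_ne_top_of_nonneg hθ0.le (by simp))⟩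
  have key : ∫⁻ y, ∫⁻ x, G x y < ∞ := by
    calc
      _ ≤ ∫⁻ y, C * f y ^ (1 / (1 - θ)) := by
        refine lintegral_mono fun y ↦ ?_
        rw [hG, lintegral_const_mul' _ _ (hft y)]
        rcases eq_or_ne (f y) 0 with h0 | h0
        · simp [h0]
        · refine (mul_le_mul_right (lintegral_mul_enorm_rpow_le_of_le hθ0 hθ hf h0 (hft y) y)
            _).trans_eq ?_
          rw [mul_left_comm]
          congr 1
          conv_lhs => enter [1]; rw [← ENNReal.rpow_one (f y)]
          rw [← ENNReal.rpow_add _ _ h0 (hft y)]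
          congr 1
          field_simp
          ring
      _ = C * ∫⁻ y, f y ^ (1 / (1 - θ)) := lintegral_const_mul' _ _ hCt
      _ < ∞ := ENNReal.mul_lt_top hCt.lt_top hfp
  calc
    _ ≤ ∫⁻ x, ∫⁻ y, (G x y + G y x) := by
      refine lintegral_mono fun x ↦ lintegral_mono fun y ↦ ?_
      simp only [hG]
      rcases le_total (f x) (f y) with h | h
      · refine le_trans (le_of_eq ?_) (le_add_right le_rfl)
        rw [if_pos h]
        ring
      · refine le_trans (le_of_eq ?_) (le_add_left le_rfl)
        rw [if_pos h, enorm_sub_rev y x]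
        ring
    _ = (∫⁻ x, ∫⁻ y, G x y) + ∫⁻ x, ∫⁻ y, G y x := by
      rw [lintegral_congr fun x ↦ lintegral_add_left (hGm.of_uncurry_left (x := x)) _]
      exact lintegral_add_left hGm.lintegral_prod_right _
    _ < ∞ := by
      rw [lintegral_lintegral_swap hGm.aemeasurable]
      exact ENNReal.add_lt_top.2 ⟨key, key⟩

/-! ### Distribution of the weights and conclusion. -/

theorem ENNReal.rpow_sum_of_nonneg {ι : Type*} (a : ℝ≥0∞) {s : Finset ι} {f : ι → ℝ}
    (hf : ∀ i ∈ s, 0 ≤ f i) : a ^ ∑ i ∈ s, f i = ∏ i ∈ s, a ^ f i := by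
  classical
  induction s using Finset.induction_on with
  | empty => simp
  | insert i s hi ih =>
    rw [Finset.sum_insert hi, Finset.prod_insert hi,
      ENNReal.rpow_add_of_nonneg _ _ (hf i (Finset.mem_insert_self _ _))
        (Finset.sum_nonneg fun j hj ↦ hf j (Finset.mem_insert_of_mem hj)),
      ih fun j hj ↦ hf j (Finset.mem_insert_of_mem hj)]

theorem prod_eq_prod_pair_rpow_mul_prod_rpow {n : ℕ} {w : IncPair n → ℝ} (hw : ∀ p, 0 ≤ w p)
    (hw1 : ∀ k, ∑ p : IncPair n, (if k = p.1.1 ∨ k = p.1.2 then w p else 0) ≤ 1)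
    (c : Fin n → ℝ≥0∞) :
    ∏ k, c k = (∏ p : IncPair n, (c p.1.1 * c p.1.2) ^ w p) *
      ∏ k, c k ^ (1 - ∑ p : IncPair n, if k = p.1.1 ∨ k = p.1.2 then w p else 0) := by
  have hv : ∀ (k : Fin n) (p : IncPair n), 0 ≤ if k = p.1.1 ∨ k = p.1.2 then w p else 0 :=
    fun k p ↦ by split_ifs; exacts [hw p, le_rfl]
  have hpair : ∀ p : IncPair n, (c p.1.1 * c p.1.2) ^ w p =
      ∏ k, c k ^ (if k = p.1.1 ∨ k = p.1.2 then w p else 0) := by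
    intro p
    rw [ENNReal.mul_rpow_of_nonneg _ _ (hw p),
      ← Finset.prod_pair (f := fun k ↦ c k ^ w p) p.2.ne,
      ← Finset.prod_subset (Finset.subset_univ {p.1.1, p.1.2})]
    · refine Finset.prod_congr rfl fun k hk ↦ ?_
      rw [if_pos (by simpa using hk)]
    · intro k _ hk
      rw [if_neg (by simpa using hk), ENNReal.rpow_zero]
  simp_rw [hpair]
  rw [Finset.prod_comm, ← Finset.prod_mul_distrib]
  refine Finset.prod_congr rfl fun k _ ↦ ?_
  rw [← ENNReal.rpow_sum_of_nonneg _ fun p _ ↦ hv k p, ← ENNReal.rpow_add_of_nonneg _ _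
    (Finset.sum_nonneg fun p _ ↦ hv k p) (sub_nonneg.2 (hw1 k)), add_sub_cancel,
    ENNReal.rpow_one]

theorem lintegral_prod_mul_prod_pair_rpow_lt_top {n : ℕ} {w : IncPair n → ℝ} (hw : ∀ p, 0 ≤ w p)
    (hw1 : ∀ k, ∑ p : IncPair n, (if k = p.1.1 ∨ k = p.1.2 then w p else 0) ≤ 1)
    {f : ℝ → ℝ≥0∞} (hf : Measurable f) (hf1 : ∫⁻ a, f a < ∞)
    {K : ℝ → ℝ → ℝ≥0∞} (hK : Measurable (Function.uncurry K))
    (hfK : ∫⁻ a, ∫⁻ b, f a * f b * K a b < ∞) :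
    ∫⁻ η : Fin n → ℝ, (∏ k, f (η k)) * ∏ p : IncPair n, K (η p.1.1) (η p.1.2) ^ w p < ∞ := by
  set S : IncPair n ⊕ Fin n → Finset (Fin n) :=
    Sum.elim (fun p ↦ {p.1.1, p.1.2}) fun k ↦ {k} with hS
  set v : IncPair n ⊕ Fin n → ℝ := Sum.elim w
    fun k ↦ 1 - ∑ p : IncPair n, if k = p.1.1 ∨ k = p.1.2 then w p else 0 with hv
  set g : IncPair n ⊕ Fin n → (Fin n → ℝ) → ℝ≥0∞ := Sum.elim
    (fun p η ↦ f (η p.1.1) * f (η p.1.2) * K (η p.1.1) (η p.1.2)) fun k η ↦ f (η k) with hg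
  have hv0 : ∀ i, 0 ≤ v i := by
    rintro (p | k)
    · exact hw p
    · exact sub_nonneg.2 (hw1 k)
  have hgm : ∀ i, Measurable (g i) := by
    rintro (p | k)
    · refine ((hf.comp (measurable_pi_apply _)).mul (hf.comp (measurable_pi_apply _))).mul ?_
      have hpair : Measurable fun η : Fin n → ℝ ↦ (η p.1.1, η p.1.2) := by fun_prop
      exact hK.comp hpair
    · exact hf.comp (measurable_pi_apply _)
  have hdep : ∀ i, DependsOn (g i) (S i : Set (Fin n)) := by
    rintro (p | k) η η' h
    · simp only [hg, Sum.elim_inl, h p.1.1 (by simp [hS]), h p.1.2 (by simp [hS])]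
    · simp only [hg, Sum.elim_inr, h k (by simp [hS])]
  have hsum : ∀ k ∈ Finset.univ, ∑ i with k ∈ S i, v i = 1 := by
    intro k _
    rw [Finset.sum_filter, Fintype.sum_sum_type]
    simp [hS, hv]
  have hprod : ∀ η : Fin n → ℝ,
      (∏ k, f (η k)) * ∏ p : IncPair n, K (η p.1.1) (η p.1.2) ^ w p = ∏ i, g i η ^ v i := by
    intro η
    rw [Fintype.prod_sum_type, prod_eq_prod_pair_rpow_mul_prod_rpow hw hw1, mul_right_comm,
      ← Finset.prod_mul_distrib]
    simp only [hg, hv, Sum.elim_inl, Sum.elim_inr]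
    congr 1
    refine Finset.prod_congr rfl fun p _ ↦ ?_
    rw [← ENNReal.mul_rpow_of_nonneg _ _ (hw p)]
  simp_rw [hprod]
  -- The base point `0` is arbitrary, as every coordinate is integrated out.
  rw [volume_pi, lintegral_eq_lmarginal_univ 0]
  refine (lmarginal_prod_rpow_le S hv0 hgm hdep Finset.univ hsum 0).trans_lt ?_
  refine ENNReal.prod_lt_top fun i _ ↦ ENNReal.rpow_lt_top_of_nonneg (hv0 i) ?_
  rw [Finset.univ_inter]
  rcases i with p | k
  · have hne : p.1.1 ≠ p.1.2 := p.2.ne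
    simp only [hS, Sum.elim_inl]
    rw [lmarginal_insert _ (hgm _) (by simpa using hne)]
    simp_rw [lmarginal_singleton]
    simpa [hg, hne, hne.symm] using hfK.ne
  · simp only [hS, Sum.elim_inr]
    rw [lmarginal_singleton]
    simpa [hg] using hf1.ne

theorem lemma7p1 (n q : ℕ) (hn : 2 ≤ n) (hq : 2 ≤ q) (H : ℝ) (hH : 1 / 2 < H) (hH' : H < 1)
    (α : IncPair n → ℕ) (hα : α ∈ multiIndexSet n q) (x : ℝ → ℝ)
    (hx1 : MemLp x 1 (volume : Measure ℝ))
    (hxH : MemLp x (ENNReal.ofReal (1 / H)) (volume : Measure ℝ)) :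
    ∫⁻ η : Fin n → ℝ, (∏ k : Fin n, ‖x (η k)‖ₑ) *
      ∏ p : IncPair n, ‖η p.1.1 - η p.1.2‖ₑ ^ ((2 * selfSimH0 H q - 2) * (α p : ℝ)) < ∞ := by
  have hq0 : (0 : ℝ) < q := by exact_mod_cast (by omega : 0 < q)
  have hH0 : 0 < H := by linarith
  -- The lemmas need genuine measurability, so `x` is replaced by a strongly measurable
  -- representative.
  obtain ⟨x', hx'm, hx'⟩ := hx1.1
  have hae : ∀ᵐ η : Fin n → ℝ, ∀ k, x (η k) = x' (η k) :=
    Filter.eventually_all.2 fun k ↦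
      (Measure.tendsto_eval_ae_ae (μ := fun _ : Fin n ↦ (volume : Measure ℝ))).eventually hx'
  have hcongr : ∫⁻ η : Fin n → ℝ, (∏ k : Fin n, ‖x (η k)‖ₑ) *
      ∏ p : IncPair n, ‖η p.1.1 - η p.1.2‖ₑ ^ ((2 * selfSimH0 H q - 2) * (α p : ℝ)) =
      ∫⁻ η : Fin n → ℝ, (∏ k : Fin n, ‖x' (η k)‖ₑ) *
        ∏ p : IncPair n, (‖η p.1.1 - η p.1.2‖ₑ ^ (-(2 * (1 - H)))) ^ ((α p : ℝ) / q) := by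
    refine lintegral_congr_ae (hae.mono fun η hη ↦ ?_)
    simp only [hη, ← ENNReal.rpow_mul]
    congr 1
    refine Finset.prod_congr rfl fun p _ ↦ ?_
    congr 1
    rw [selfSimH0]
    field_simp
    ring
  rw [hcongr]
  refine lintegral_prod_mul_prod_pair_rpow_lt_top (f := fun a ↦ ‖x' a‖ₑ)
    (K := fun a b ↦ ‖a - b‖ₑ ^ (-(2 * (1 - H)))) (fun p ↦ by positivity) (fun k ↦ ?_)
    hx'm.measurable.enorm ?_ ((measurable_fst.sub measurable_snd).enorm.pow_const _)
    (lintegral_lintegral_mul_enorm_sub_rpow_lt_top (by linarith) (by linarith)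
      hx'm.measurable.enorm (fun _ ↦ enorm_ne_top) ?_)
  · have h : ((∑ p : IncPair n, if k = p.1.1 ∨ k = p.1.2 then α p else 0 : ℕ) : ℝ) ≤ q := by
      exact_mod_cast hα k
    rw [← div_le_one hq0] at h
    refine le_of_eq_of_le ?_ h
    rw [Nat.cast_sum, Finset.sum_div]
    refine Finset.sum_congr rfl fun p _ ↦ ?_
    split_ifs <;> simp
  · have h := (memLp_congr_ae hx').1 hx1
    simpa [eLpNorm_one_eq_lintegral_enorm] using h.2
  · have h := (memLp_congr_ae hx').1 hxH
    have h0 : 0 < 1 / H := by positivity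
    have := lintegral_rpow_enorm_lt_top_of_eLpNorm_lt_top (by simpa using hH0)
      ENNReal.ofReal_ne_top h.2
    rw [ENNReal.toReal_ofReal h0.le] at this
    rwa [sub_sub_cancel]
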